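/- Let $p$ be a prime and let $m \ge 2$ and $n \ge 3$ be integers. Let $G_n(m,p)$ be the group generated by $n+1$ elements $a_0, a_1, \ldots, a_n$ subject to the defining relations $$a_1^p = 1,\quad a_2^{p^m} = 1,\quad a_i^{p^2} = 1 \ \ (3 \le i \le n),\quad a_{n-1}^p = a_0^p,$$ $$[a_1,a_0] = 1,\quad [a_n,a_0] = a_1,\quad [a_{i-1},a_0] = a_i^p \ \ (3 \le i \le n),$$ $$[a_i,a_j] = 1 \ \ (1 \le i < j \le n),$$ where $[x,y] = x^{-1}y^{-1}xy$. Call a group Miller if its automorphism group is abelian. Then $G_n(m,p)$ is Miller if and only if $p = 2$. -/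

import Mathlib

/-- The commutator `[x, y] = x⁻¹ y⁻¹ x y`. -/
def rightComm {G : Type*} [Group G] (x y : G) : G := x⁻¹ * y⁻¹ * x * y

/-- The free generator `a_i`, for `0 ≤ i ≤ n`, of the free group on `a_0, …, a_n`. -/
def freeGen (n : ℕ) (i : ℕ) (hi : i ≤ n) : FreeGroup (Fin (n + 1)) :=
  FreeGroup.of ⟨i, Nat.lt_succ_of_le hi⟩

/-- The defining relators of `G_n(m,p)`; an equation `u = v` gives the relator `u * v⁻¹`.
(In the relations where an index would be out of range when `n < 3`, the bound is a premise.) -/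
inductive GnRelator (n m p : ℕ) : FreeGroup (Fin (n + 1)) → Prop
  /-- `a_1 ^ p = 1` -/
  | pow_one (h : 1 ≤ n) : GnRelator n m p (freeGen n 1 h ^ p)
  /-- `a_2 ^ (p ^ m) = 1` -/
  | pow_two (h : 2 ≤ n) : GnRelator n m p (freeGen n 2 h ^ (p ^ m))
  /-- `a_i ^ (p ^ 2) = 1` for `3 ≤ i ≤ n` -/
  | pow_ge_three (i : ℕ) (h3 : 3 ≤ i) (h : i ≤ n) : GnRelator n m p (freeGen n i h ^ (p ^ 2))
  /-- `a_{n-1} ^ p = a_0 ^ p` -/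
  | pow_zero : GnRelator n m p
      (freeGen n (n - 1) (Nat.sub_le n 1) ^ p * (freeGen n 0 (Nat.zero_le n) ^ p)⁻¹)
  /-- `[a_1, a_0] = 1` -/
  | comm_one_zero (h : 1 ≤ n) : GnRelator n m p
      (rightComm (freeGen n 1 h) (freeGen n 0 (Nat.zero_le n)))
  /-- `[a_n, a_0] = a_1` -/
  | comm_last_zero (h : 1 ≤ n) : GnRelator n m p
      (rightComm (freeGen n n le_rfl) (freeGen n 0 (Nat.zero_le n)) * (freeGen n 1 h)⁻¹)
  /-- `[a_{i-1}, a_0] = a_i ^ p` for `3 ≤ i ≤ n` -/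
  | comm_pred_zero (i : ℕ) (h3 : 3 ≤ i) (h : i ≤ n) : GnRelator n m p
      (rightComm (freeGen n (i - 1) ((Nat.sub_le i 1).trans h)) (freeGen n 0 (Nat.zero_le n)) *
        (freeGen n i h ^ p)⁻¹)
  /-- `[a_i, a_j] = 1` for `1 ≤ i < j ≤ n` -/
  | comm_pos (i j : ℕ) (h1 : 1 ≤ i) (hij : i < j) (h : j ≤ n) : GnRelator n m p
      (rightComm (freeGen n i (hij.le.trans h)) (freeGen n j h))

/-- The group `G_n(m,p)`, generated by `a_0, …, a_n` subject to the relations above. -/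
abbrev Gn (n m p : ℕ) : Type :=
  PresentedGroup {w : FreeGroup (Fin (n + 1)) | GnRelator n m p w}

/-- A group is a Miller group if its automorphism group is commutative. -/
def IsMillerGroup (G : Type*) [Group G] : Prop :=
  ∀ φ ψ : MulAut G, φ * ψ = ψ * φ

/-! For odd `p`, two automorphisms fail to commute. One sends `a_0` to `a_0 a_1` and fixes the other
generators. The other inverts `a_1, …, a_n` and sends `a_0` to `a_0 a_{n-1}⁻²`. Their two composites
send `a_0` to `a_0 a_{n-1}⁻² a_1` and `a_0 a_{n-1}⁻² a_1⁻¹`, and `a_1² ≠ 1` is visible in a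
Heisenberg quotient (`Gn.not_isMillerGroup`).

For `p = 2`, the group is an extension of order two of the abelian group `A = ⟨a_1, …, a_n⟩`, made
explicit as `Model` (`exists_mulEquiv`). Every automorphism preserves `A` (`tw_map`), acts trivially
on `A` modulo the centre (`par_base`) and moves `a_0` by a central element `shift` (`par_shift`).
Write it on `A` as `1 + dev`. Then `dev` maps `A` into the centre, kills commutators, and on the
centre is governed by one scalar, its effect on the `a_2`-coordinate. Hence these deviations commute
(`dev_dev_comm`). The relation `a_0² = a_{n-1}²` ties `shift` to `dev a_{n-1}`, so the images of
`a_0` agree as well (`dev_shift_comm`). -/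

/-- `f 0, …, f n` satisfy the defining relations of `G_n(m,p)`. -/
structure GnFamily (n m p : ℕ) {H : Type*} [Group H] (f : ℕ → H) : Prop where
  pow_one : f 1 ^ p = 1
  pow_two : f 2 ^ p ^ m = 1
  pow_ge_three : ∀ i, 3 ≤ i → i ≤ n → f i ^ p ^ 2 = 1
  pow_zero : f (n - 1) ^ p = f 0 ^ p
  comm_one_zero : rightComm (f 1) (f 0) = 1
  comm_last_zero : rightComm (f n) (f 0) = f 1
  comm_pred_zero : ∀ i, 3 ≤ i → i ≤ n → rightComm (f (i - 1)) (f 0) = f i ^ p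
  comm_pos : ∀ i j, 1 ≤ i → i < j → j ≤ n → rightComm (f i) (f j) = 1

theorem map_rightComm {G H : Type*} [Group G] [Group H] (φ : G →* H) (x y : G) :
    φ (rightComm x y) = rightComm (φ x) (φ y) := by
  simp [rightComm]

theorem rightComm_eq_iff {G : Type*} [Group G] {x y z : G} :
    rightComm x y = z ↔ x * y = y * (x * z) := by
  unfold rightComm
  constructor
  · rintro rfl; group
  · intro h
    rw [mul_assoc, h]; group

theorem rightComm_eq_one_iff {G : Type*} [Group G] {x y : G} :
    rightComm x y = 1 ↔ Commute x y := by
  rw [rightComm_eq_iff, mul_one]; rfl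

/-! ### Universal property of the presentation -/

namespace Gn

variable {n m p : ℕ}

/-- The generator `a_i` of `G_n(m,p)`, extended by `1` to all natural indices. -/
def gen (n m p i : ℕ) : Gn n m p :=
  if h : i ≤ n then PresentedGroup.of ⟨i, Nat.lt_succ_of_le h⟩ else 1

theorem mk_freeGen (i : ℕ) (hi : i ≤ n) :
    PresentedGroup.mk {w | GnRelator n m p w} (freeGen n i hi) = gen n m p i := by
  simp only [gen, hi, dite_true]; rfl

theorem mk_eq_one {w : FreeGroup (Fin (n + 1))} (h : GnRelator n m p w) :
    PresentedGroup.mk {w | GnRelator n m p w} w = 1 :=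
  PresentedGroup.one_of_mem h

theorem gnFamily_gen (hn : 3 ≤ n) : GnFamily n m p (gen n m p) where
  pow_one := by
    simpa [mk_freeGen] using mk_eq_one (GnRelator.pow_one (m := m) (p := p) (show 1 ≤ n by lia))
  pow_two := by
    simpa [mk_freeGen] using mk_eq_one (GnRelator.pow_two (m := m) (p := p) (show 2 ≤ n by lia))
  pow_ge_three i h3 h := by
    simpa [mk_freeGen] using mk_eq_one (GnRelator.pow_ge_three (m := m) (p := p) i h3 h)
  pow_zero := by
    simpa [mk_freeGen, mul_inv_eq_one] using mk_eq_one (GnRelator.pow_zero (n := n) (m := m) (p := p))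
  comm_one_zero := by
    simpa [mk_freeGen, map_rightComm] using
      mk_eq_one (GnRelator.comm_one_zero (m := m) (p := p) (show 1 ≤ n by lia))
  comm_last_zero := by
    simpa [mk_freeGen, map_rightComm, mul_inv_eq_one] using
      mk_eq_one (GnRelator.comm_last_zero (m := m) (p := p) (show 1 ≤ n by lia))
  comm_pred_zero i h3 h := by
    simpa [mk_freeGen, map_rightComm, mul_inv_eq_one] using
      mk_eq_one (GnRelator.comm_pred_zero (m := m) (p := p) i h3 h)
  comm_pos i j h1 hij h := by
    simpa [mk_freeGen, map_rightComm] using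
      mk_eq_one (GnRelator.comm_pos (m := m) (p := p) i j h1 hij h)

variable {H : Type*} [Group H] {f : ℕ → H}

theorem lift_eq_one (hf : GnFamily n m p f) :
    ∀ w ∈ {w | GnRelator n m p w}, FreeGroup.lift (fun i : Fin (n + 1) => f i) w = 1 := by
  rintro w (_ | _ | ⟨i, h3, h⟩ | _ | _ | _ | ⟨i, h3, h⟩ | ⟨i, j, h1, hij, h⟩)
  · simpa [freeGen] using hf.pow_one
  · simpa [freeGen] using hf.pow_two
  · simpa [freeGen] using hf.pow_ge_three i h3 h
  · simpa [freeGen, mul_inv_eq_one] using hf.pow_zero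
  · simpa [freeGen, map_rightComm] using hf.comm_one_zero
  · simpa [freeGen, map_rightComm, mul_inv_eq_one] using hf.comm_last_zero
  · simpa [freeGen, map_rightComm, mul_inv_eq_one] using hf.comm_pred_zero i h3 h
  · simpa [freeGen, map_rightComm] using hf.comm_pos i j h1 hij h

/-- The homomorphism out of `G_n(m,p)` sending `a_i` to `f i`. -/
def lift (hf : GnFamily n m p f) : Gn n m p →* H :=
  PresentedGroup.toGroup (lift_eq_one hf)

theorem lift_gen (hf : GnFamily n m p f) {i : ℕ} (hi : i ≤ n) : lift hf (gen n m p i) = f i := by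
  simp only [gen, hi, dite_true, lift]
  exact PresentedGroup.toGroup.of _

theorem hom_ext {φ ψ : Gn n m p →* H}
    (h : ∀ i ≤ n, φ (gen n m p i) = ψ (gen n m p i)) : φ = ψ := by
  refine PresentedGroup.ext fun i => ?_
  have hi := Nat.lt_succ_iff.mp i.2
  have := h i hi
  simpa only [gen, hi, dite_true] using this

end Gn

/-- Collection in nilpotency class two: moving `y ^ k` past `x` costs `c ^ k`, and these costs add
up to the binomial exponent. -/
theorem mul_pow_of_commute_comm {G : Type*} [Group G] {x y c : G} (h : y * x = x * (y * c))
    (hx : Commute c x) (hy : Commute c y) (k : ℕ) :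
    (x * y) ^ k = x ^ k * y ^ k * c ^ k.choose 2 := by
  have key : ∀ k : ℕ, y ^ k * x = x * (y ^ k * c ^ k) := by
    intro k
    induction k with
    | zero => simp
    | succ k ih =>
      calc y ^ (k + 1) * x = y * (y ^ k * x) := by rw [pow_succ', mul_assoc]
        _ = y * x * (y ^ k * c ^ k) := by rw [ih, mul_assoc]
        _ = x * (y * (c * y ^ k) * c ^ k) := by rw [h]; simp only [mul_assoc]
        _ = x * (y ^ (k + 1) * c ^ (k + 1)) := by
          rw [(hy.pow_right k).eq, pow_succ', pow_succ' c]; simp only [mul_assoc]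
  induction k with
  | zero => simp
  | succ k ih =>
    calc (x * y) ^ (k + 1) = x ^ k * y ^ k * (c ^ k.choose 2 * (x * y)) := by
          rw [pow_succ, ih, mul_assoc]
      _ = x ^ k * (y ^ k * x) * (y * c ^ k.choose 2) := by
          rw [((hx.mul_right hy).pow_left _).eq]; simp only [mul_assoc]
      _ = x ^ k * x * (y ^ k * (c ^ k * y) * c ^ k.choose 2) := by
          rw [key]; simp only [mul_assoc]
      _ = x ^ (k + 1) * y ^ (k + 1) * c ^ (k + 1).choose 2 := by
          rw [(hy.pow_left k).eq, Nat.choose_succ_succ' k 1, Nat.choose_one_right, pow_add c,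
            pow_succ x, pow_succ y]
          simp only [mul_assoc]

/-! ### A Heisenberg quotient in which `a_1` survives -/

/-- The Heisenberg group over a ring. -/
@[ext]
structure Heisenberg (R : Type*) where
  x : R
  y : R
  z : R

namespace Heisenberg

variable {R : Type*} [CommRing R]

instance : Mul (Heisenberg R) := ⟨fun a b => ⟨a.x + b.x, a.y + b.y, a.z + b.z + a.x * b.y⟩⟩
instance : One (Heisenberg R) := ⟨⟨0, 0, 0⟩⟩
instance : Inv (Heisenberg R) := ⟨fun a => ⟨-a.x, -a.y, -a.z + a.x * a.y⟩⟩

theorem mul_def (a b : Heisenberg R) :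
    a * b = ⟨a.x + b.x, a.y + b.y, a.z + b.z + a.x * b.y⟩ := rfl

theorem one_def : (1 : Heisenberg R) = ⟨0, 0, 0⟩ := rfl

theorem inv_def (a : Heisenberg R) : a⁻¹ = ⟨-a.x, -a.y, -a.z + a.x * a.y⟩ := rfl

instance : Group (Heisenberg R) :=
  Group.ofLeftAxioms
    (fun a b c => by simp only [mul_def]; ext <;> simp only <;> ring)
    (fun a => by simp only [mul_def, one_def]; ext <;> simp only <;> ring)
    (fun a => by simp only [mul_def, one_def, inv_def]; ext <;> simp only <;> ring)

theorem pow_eq (a : Heisenberg R) (h : a.x * a.y = 0) (k : ℕ) :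
    a ^ k = ⟨k * a.x, k * a.y, k * a.z⟩ := by
  induction k with
  | zero => simp [one_def]
  | succ k ih =>
    rw [pow_succ, ih, mul_def]
    ext
    · simp only; push_cast; ring
    · simp only; push_cast; ring
    · simp only [mul_assoc, h]; push_cast; ring

/-- The images of `a_0, …, a_n` in the Heisenberg quotient of `G_n(m,p)`. -/
def family (R : Type*) [CommRing R] (n i : ℕ) : Heisenberg R :=
  if i = 0 then ⟨0, 1, 0⟩ else if i = 1 then ⟨0, 0, 1⟩ else if i = n then ⟨1, 0, 0⟩ else 1

theorem gnFamily {n m p : ℕ} (hn : 3 ≤ n) (hm : 2 ≤ m) :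
    GnFamily n m p (family (ZMod p) n) := by
  have hpow : ∀ i, family (ZMod p) n i ^ p = 1 := by
    intro i
    have : (family (ZMod p) n i).x * (family (ZMod p) n i).y = 0 := by
      unfold family; split_ifs <;> simp [one_def]
    simp [pow_eq _ this, one_def]
  have hpow' : ∀ i k, k ≠ 0 → family (ZMod p) n i ^ p ^ k = 1 := by
    intro i k hk
    obtain ⟨k, rfl⟩ := Nat.exists_eq_succ_of_ne_zero hk
    rw [pow_succ', pow_mul, hpow, one_pow]
  have hmid : ∀ i, 2 ≤ i → i < n → family (ZMod p) n i = 1 := by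
    intro i h2 hi
    simp [family, show i ≠ 0 by lia, show i ≠ 1 by lia, show i ≠ n by lia]
  have hcentral : ∀ g : Heisenberg (ZMod p), Commute (family (ZMod p) n 1) g := by
    intro g
    simp [family, Commute, SemiconjBy, mul_def, add_comm]
  refine ⟨hpow 1, hpow' _ _ (by lia), fun i _ _ => hpow' _ _ (by lia), by rw [hpow, hpow],
    rightComm_eq_one_iff.2 (hcentral _), ?_, fun i h3 hi => ?_, fun i j h1 hij hj => ?_⟩
  · simp [rightComm_eq_iff, family, mul_def, show n ≠ 0 by lia, show n ≠ 1 by lia]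
  · rw [hmid _ (by lia) (by lia), hpow, rightComm_eq_one_iff]
    exact Commute.one_left _
  · rw [rightComm_eq_one_iff]
    obtain rfl | h2 := h1.eq_or_lt
    · exact hcentral _
    · rw [hmid i h2 (by lia)]
      exact Commute.one_left _

end Heisenberg

namespace Gn

variable {n m p : ℕ}

/-- In the Heisenberg group over `ZMod p`, the image of `a_1` has central coordinate `1`, so its
square is trivial only if `p ∣ 2`. -/
theorem gen_one_sq_ne_one (hn : 3 ≤ n) (hm : 2 ≤ m) (hp : p.Prime) (h2 : p ≠ 2) :
    gen n m p 1 ^ 2 ≠ 1 := by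
  intro h
  have := congrArg (fun g => (lift (Heisenberg.gnFamily hn hm) g).z) h
  simp only [map_pow, lift_gen _ (show 1 ≤ n by lia), map_one] at this
  rw [Heisenberg.pow_eq _ (by simp [Heisenberg.family])] at this
  simp only [Heisenberg.family, Heisenberg.one_def, one_ne_zero, if_true, if_false, mul_one] at this
  have hdvd : p ∣ 2 := (ZMod.natCast_eq_zero_iff 2 p).1 this
  exact h2 ((Nat.prime_dvd_prime_iff_eq hp Nat.prime_two).1 hdvd)

end Gn

/-! ### Substitutions that preserve the relations -/

namespace GnFamily

variable {n m p : ℕ} {H : Type*} [Group H] {f : ℕ → H}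

theorem commute (hf : GnFamily n m p f) {i j : ℕ} (hi : 1 ≤ i) (hin : i ≤ n) (hj : 1 ≤ j)
    (hjn : j ≤ n) : Commute (f i) (f j) := by
  rcases lt_trichotomy i j with h | rfl | h
  · exact rightComm_eq_one_iff.1 (hf.comm_pos i j hi h hjn)
  · exact Commute.refl _
  · exact (rightComm_eq_one_iff.1 (hf.comm_pos j i hj h hin)).symm

/-- The relations survive multiplying `a_0` by an element commuting with every `a_i`. -/
theorem update_mul_central (hf : GnFamily n m p f) (hn : 3 ≤ n) {z : H} (hz : z ^ p = 1)
    (hc : ∀ i ≤ n, Commute z (f i)) :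
    GnFamily n m p (Function.update f 0 (f 0 * z)) := by
  have key : ∀ i ≤ n, ∀ c, rightComm (f i) (f 0) = c → rightComm (f i) (f 0 * z) = c := by
    intro i hi c h
    rw [rightComm_eq_iff] at h ⊢
    have hzc : z * (f i * c) = f i * c * z := by
      have : f i * c = (f 0)⁻¹ * (f i * f 0) := by rw [h]; group
      rw [this]
      exact ((hc 0 (by lia)).inv_right.mul_right ((hc i hi).mul_right (hc 0 (by lia)))).eq
    rw [← mul_assoc, h, mul_assoc (f 0) z, hzc]
    simp only [mul_assoc]
  have hne : ∀ i, i ≠ 0 → Function.update f 0 (f 0 * z) i = f i := fun i hi => by simp [hi]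
  constructor
  · rw [hne _ (by lia)]; exact hf.pow_one
  · rw [hne _ (by lia)]; exact hf.pow_two
  · intro i h3 h; rw [hne _ (by lia)]; exact hf.pow_ge_three i h3 h
  · rw [hne _ (by lia), Function.update_self, (hc 0 (by lia)).symm.mul_pow, hz, mul_one]
    exact hf.pow_zero
  · rw [hne _ (by lia), Function.update_self]; exact key _ (by lia) _ hf.comm_one_zero
  · rw [hne _ (by lia), hne 1 (by lia), Function.update_self]
    exact key _ (by lia) _ hf.comm_last_zero
  · intro i h3 h; rw [hne _ (by lia), hne i (by lia), Function.update_self]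
    exact key _ (by lia) _ (hf.comm_pred_zero i h3 h)
  · intro i j h1 hij h; rw [hne _ (by lia), hne _ (by lia)]; exact hf.comm_pos i j h1 hij h

/-- For odd `p` the relations survive inverting `a_1, …, a_n` and fixing `a_0 a_{n-1}⁻¹`. -/
theorem update_inv (hf : GnFamily n m p f) (hn : 3 ≤ n) (hp : p.Prime) (h2 : p ≠ 2) :
    GnFamily n m p (Function.update (fun i => (f i)⁻¹) 0 (f 0 * (f (n - 1))⁻¹ ^ 2)) := by
  have hne : ∀ i, i ≠ 0 →
      Function.update (fun i => (f i)⁻¹) 0 (f 0 * (f (n - 1))⁻¹ ^ 2) i = (f i)⁻¹ :=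
    fun i hi => by simp [hi]
  have key : ∀ i c, 1 ≤ i → i ≤ n → Commute (f i) c → Commute (f (n - 1)) c →
      rightComm (f i) (f 0) = c → rightComm (f i)⁻¹ (f 0 * (f (n - 1))⁻¹ ^ 2) = c⁻¹ := by
    intro i c h1 hi hic hnc h
    have hin : Commute (f (n - 1)) (f i) := hf.commute (by lia) (by lia) h1 hi
    rw [rightComm_eq_iff] at h ⊢
    have hinv : (f i)⁻¹ * f 0 = f 0 * ((f i)⁻¹ * c⁻¹) := by
      have : f 0 * ((f i)⁻¹ * c⁻¹) = f 0 * (f i * c)⁻¹ := by rw [hic.eq, mul_inv_rev]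
      rw [this, inv_mul_eq_iff_eq_mul, ← mul_assoc, h]; group
    have hcomm : Commute ((f (n - 1))⁻¹ ^ 2) ((f i)⁻¹ * c⁻¹) :=
      (hin.inv_inv.mul_right hnc.inv_inv).pow_left 2
    rw [← mul_assoc, hinv, mul_assoc (f 0), mul_assoc (f 0), hcomm.eq]
  have hlast := rightComm_eq_iff.1 hf.comm_last_zero
  -- Conjugation by `a_0` multiplies `a_n` by `a_1`, which commutes with `a_n` and dies in the
  -- `p`-th power.
  have hdn : Commute (f n ^ p) (f 0) := by
    have h : (f 0)⁻¹ * f n * f 0 = f n * f 1 := by rw [mul_assoc, hlast]; group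
    have h' : (f 0)⁻¹ * f n ^ p * f 0 = f n ^ p := by
      have := conj_pow (i := p) (a := (f 0)⁻¹) (b := f n)
      rw [inv_inv, h, (hf.commute (by lia) le_rfl le_rfl (by lia) : Commute (f n) (f 1)).mul_pow,
        hf.pow_one, mul_one] at this
      exact this.symm
    rw [mul_assoc, inv_mul_eq_iff_eq_mul] at h'
    exact h'
  have hcomm : ∀ i j, 1 ≤ i → i ≤ n → 1 ≤ j → j ≤ n → Commute (f i) (f j ^ p) :=
    fun i j h1 h2 h3 h4 => (hf.commute h1 h2 h3 h4).pow_right p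
  constructor
  · rw [hne _ (by lia), inv_pow, hf.pow_one, inv_one]
  · rw [hne _ (by lia), inv_pow, hf.pow_two, inv_one]
  · intro i h3 h; rw [hne _ (by lia), inv_pow, hf.pow_ge_three i h3 h, inv_one]
  · rw [hne _ (by lia), Function.update_self]
    have hpred : f (n - 1) * f 0 = f 0 * (f (n - 1) * f n ^ p) :=
      rightComm_eq_iff.1 (hf.comm_pred_zero n hn le_rfl)
    have hnn : Commute (f (n - 1)) (f n ^ p) := hcomm _ _ (by lia) (by lia) (by lia) le_rfl
    have hy : (f (n - 1))⁻¹ ^ 2 * f 0 = f 0 * ((f (n - 1))⁻¹ ^ 2 * (f n ^ p)⁻¹ ^ 2) := by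
      have h : (f 0)⁻¹ * f (n - 1) * f 0 = f (n - 1) * f n ^ p := by rw [mul_assoc, hpred]; group
      have := conj_zpow (i := -2) (a := (f 0)⁻¹) (b := f (n - 1))
      rw [inv_inv, h, hnn.mul_zpow] at this
      have h2 : ∀ g : H, g⁻¹ ^ 2 = g ^ (-2 : ℤ) := fun g => by
        rw [inv_pow, zpow_neg, zpow_ofNat]
      rw [h2, h2, this]; group
    -- Oddness of `p` enters here: `p` divides `p.choose 2`, so the correction term is a power of
    -- `a_n ^ p ^ 2 = 1`.
    have hpow : ((f n ^ p)⁻¹ ^ 2) ^ p.choose 2 = 1 := by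
      obtain ⟨k, hk⟩ : p ∣ p.choose 2 :=
        hp.dvd_choose_self (by lia) (lt_of_le_of_ne hp.two_le (Ne.symm h2))
      rw [hk, ← pow_mul, inv_pow, ← pow_mul, show p * (2 * (p * k)) = p ^ 2 * (2 * k) by ring,
        pow_mul, hf.pow_ge_three n hn le_rfl, one_pow, inv_one]
    -- The `p`-th power of the new `a_0` is `a_0 ^ p * a_{n-1} ^ (-2p)`, which is `a_{n-1} ^ (-p)`
    -- because `a_0 ^ p = a_{n-1} ^ p`.
    rw [mul_pow_of_commute_comm hy (hdn.inv_left.pow_left 2)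
      ((hnn.symm.inv_inv.pow_left 2).pow_right 2), hpow, mul_one, ← hf.pow_zero, ← pow_mul,
      mul_comm 2 p, pow_mul, inv_pow, sq]
    group
  · rw [hne _ (by lia), Function.update_self, key 1 1 le_rfl (by lia) (Commute.one_right _)
      (Commute.one_right _) hf.comm_one_zero, inv_one]
  · rw [hne _ (by lia), hne 1 (by lia), Function.update_self]
    exact key _ _ (by lia) le_rfl (hf.commute (by lia) le_rfl le_rfl (by lia))
      (hf.commute (by lia) (by lia) le_rfl (by lia)) hf.comm_last_zero
  · intro i h3 h; rw [hne _ (by lia), hne i (by lia), Function.update_self, inv_pow (f i)]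
    exact key _ _ (by lia) (by lia) (hcomm _ _ (by lia) (by lia) (by lia) h)
      (hcomm _ _ (by lia) (by lia) (by lia) h) (hf.comm_pred_zero i h3 h)
  · intro i j h1 hij h; rw [hne _ (by lia), hne _ (by lia), rightComm_eq_one_iff]
    exact (hf.commute h1 (by lia) (by lia) h).inv_inv

end GnFamily

/-! ### Odd `p`: two automorphisms that do not commute -/

namespace Gn

variable {n m p : ℕ}

theorem not_isMillerGroup (hn : 3 ≤ n) (hm : 2 ≤ m) (hp : p.Prime) (h2 : p ≠ 2) :
    ¬ IsMillerGroup (Gn n m p) := by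
  have hg : GnFamily n m p (gen n m p) := gnFamily_gen hn
  have hc : ∀ i ≤ n, Commute (gen n m p 1) (gen n m p i) := by
    intro i hi
    obtain rfl | h := Nat.eq_zero_or_pos i
    · exact rightComm_eq_one_iff.1 hg.comm_one_zero
    · exact hg.commute le_rfl (by lia) h hi
  have hφ := hg.update_mul_central hn hg.pow_one hc
  have hφ' := hg.update_mul_central hn (z := (gen n m p 1)⁻¹) (by rw [inv_pow, hg.pow_one, inv_one])
    fun i hi => (hc i hi).inv_left
  have hψ := hg.update_inv hn hp h2
  have hφ0 : lift hφ (gen n m p 0) = gen n m p 0 * gen n m p 1 := by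
    rw [lift_gen hφ (by lia), Function.update_self]
  have hφ0' : lift hφ' (gen n m p 0) = gen n m p 0 * (gen n m p 1)⁻¹ := by
    rw [lift_gen hφ' (by lia), Function.update_self]
  have hψ0 : lift hψ (gen n m p 0) = gen n m p 0 * (gen n m p (n - 1))⁻¹ ^ 2 := by
    rw [lift_gen hψ (by lia), Function.update_self]
  have hφi : ∀ i ≤ n, i ≠ 0 → lift hφ (gen n m p i) = gen n m p i := fun i hi h0 => by
    rw [lift_gen hφ hi, Function.update_of_ne h0]
  have hφi' : ∀ i ≤ n, i ≠ 0 → lift hφ' (gen n m p i) = gen n m p i := fun i hi h0 => by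
    rw [lift_gen hφ' hi, Function.update_of_ne h0]
  have hψi : ∀ i ≤ n, i ≠ 0 → lift hψ (gen n m p i) = (gen n m p i)⁻¹ := fun i hi h0 => by
    rw [lift_gen hψ hi, Function.update_of_ne h0]
  let φ : MulAut (Gn n m p) := MonoidHom.toMulEquiv (lift hφ) (lift hφ')
    (hom_ext fun i hi => by
      obtain rfl | h := eq_or_ne i 0
      · simp [hφ0, hφ0', hφi' 1 (by lia)]
      · simp [hφi i hi h, hφi' i hi h])
    (hom_ext fun i hi => by
      obtain rfl | h := eq_or_ne i 0
      · simp [hφ0, hφ0', hφi 1 (by lia)]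
      · simp [hφi i hi h, hφi' i hi h])
  have hψψ : (lift hψ).comp (lift hψ) = MonoidHom.id _ := hom_ext fun i hi => by
    obtain rfl | h := eq_or_ne i 0
    · rw [MonoidHom.comp_apply, hψ0, map_mul, hψ0, map_pow, map_inv,
        hψi (n - 1) (by lia) (by lia), MonoidHom.id_apply]
      group
    · rw [MonoidHom.comp_apply, hψi i hi h, map_inv, hψi i hi h, inv_inv, MonoidHom.id_apply]
  let ψ : MulAut (Gn n m p) := MonoidHom.toMulEquiv (lift hψ) (lift hψ) hψψ hψψ
  intro h
  have h0 : lift hφ (lift hψ (gen n m p 0)) = lift hψ (lift hφ (gen n m p 0)) :=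
    DFunLike.congr_fun (h φ ψ) (gen n m p 0)
  rw [hψ0, hφ0, map_mul, map_mul, hφ0, hψ0, map_pow, map_inv, hφi (n - 1) (by lia) (by lia),
    hψi 1 (by lia) one_ne_zero, mul_assoc, mul_assoc, mul_left_cancel_iff,
    (((hc (n - 1) (by lia)).inv_right.pow_right 2)).eq, mul_left_cancel_iff,
    eq_inv_iff_mul_eq_one, ← sq] at h0
  exact gen_one_sq_ne_one hn hm hp h2 h0

end Gn

/-! ### An explicit model for `p = 2`, with `n = k + 3` and `m = l + 2` -/

namespace GnTwo

variable {k l : ℕ}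

/-- The additive form of the abelian subgroup `⟨a_1, …, a_{k+3}⟩` of `G_{k+3}(l+2,2)`. -/
abbrev Base (k l : ℕ) : Type := ZMod 2 × ZMod (2 ^ (l + 2)) × (Fin (k + 1) → ZMod 4)

/-- Reduction modulo `2`. -/
def red (l : ℕ) : ZMod (2 ^ (l + 2)) →+* ZMod 2 :=
  ZMod.castHom (dvd_pow_self 2 (by lia)) _

/-- Reduction modulo `2`. -/
def redFour : ZMod 4 →+* ZMod 2 := ZMod.castHom (by norm_num) _

/-- The embedding of `ZMod 2` in `ZMod 4`. -/
def dbl : ZMod 2 →+ ZMod 4 where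
  toFun x := if x = 0 then 0 else 2
  map_zero' := rfl
  map_add' := by decide

theorem dbl_redFour (x : ZMod 4) : dbl (redFour x) = 2 * x := by
  revert x; decide

theorem dbl_injective : Function.Injective dbl := by decide

theorem red_eq_zero_iff {x : ZMod (2 ^ (l + 2))} : red l x = 0 ↔ ∃ y, x = 2 * y := by
  constructor
  · obtain ⟨a, rfl⟩ := ZMod.intCast_surjective x
    intro h
    rw [map_intCast, ZMod.intCast_zmod_eq_zero_iff_dvd] at h
    obtain ⟨b, rfl⟩ := h
    exact ⟨b, by push_cast; rfl⟩
  · rintro ⟨y, rfl⟩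
    rw [map_mul, map_ofNat, show (OfNat.ofNat 2 : ZMod 2) = 0 from rfl, zero_mul]

/-- An element killed by `2` is a multiple of `2 ^ (l + 1)`, which is even. This is where `m ≥ 2`
matters. -/
theorem red_eq_zero_of_two_mul {x : ZMod (2 ^ (l + 2))} (h : 2 * x = 0) : red l x = 0 := by
  obtain ⟨a, rfl⟩ := ZMod.intCast_surjective x
  rw [map_intCast, ZMod.intCast_zmod_eq_zero_iff_dvd]
  have h' : ((2 * a : ℤ) : ZMod (2 ^ (l + 2))) = 0 := by push_cast; exact h
  rw [ZMod.intCast_zmod_eq_zero_iff_dvd] at h'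
  push_cast at h' ⊢
  rw [pow_succ', mul_dvd_mul_iff_left two_ne_zero] at h'
  exact (dvd_pow_self 2 (by lia)).trans h'

/-- The class modulo the centre, in coordinates. -/
def par : Base k l →+ (Fin (k + 2) → ZMod 2) where
  toFun x := Fin.cons (red l x.2.1) (fun j => redFour (x.2.2 j))
  map_zero' := by
    ext i; refine Fin.cases ?_ (fun j => ?_) i <;> simp
  map_add' x y := by
    ext i; refine Fin.cases ?_ (fun j => ?_) i <;> simp

@[simp] theorem par_zero (x : Base k l) : par x 0 = red l x.2.1 := rfl

@[simp] theorem par_succ (x : Base k l) (j : Fin (k + 1)) : par x j.succ = redFour (x.2.2 j) := rfl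

/-- The commutator with `a_0`, as a function of the class modulo the centre. -/
def nu : (Fin (k + 2) → ZMod 2) →+ Base k l where
  toFun y := (y (Fin.last _), 0, fun j => dbl (y j.castSucc))
  map_zero' := by simp; rfl
  map_add' x y := by
    ext <;> simp

theorem nu_apply (y : Fin (k + 2) → ZMod 2) :
    (nu y : Base k l) = (y (Fin.last _), 0, fun j => dbl (y j.castSucc)) := rfl

theorem nu_injective : Function.Injective (nu : _ →+ Base k l) := by
  intro x y h
  simp only [nu_apply, Prod.mk.injEq, true_and] at h
  ext i
  refine Fin.lastCases h.1 (fun j => dbl_injective (congrFun h.2 j)) i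

theorem par_nu (y : Fin (k + 2) → ZMod 2) : par (nu y : Base k l) = 0 := by
  ext i
  refine Fin.cases ?_ (fun j => ?_) i
  · simp [nu_apply]
  · simp only [par_succ, nu_apply, Pi.zero_apply]
    generalize y j.castSucc = z
    revert z; decide

theorem two_nsmul_base (x : Base k l) : 2 • x = (0, 2 * x.2.1, fun j => dbl (par x j.succ)) := by
  ext
  · simp [show (2 : ZMod 2) = 0 from rfl]
  · simp
  · simp [dbl_redFour]

theorem par_two_nsmul (x : Base k l) : par (2 • x) = 0 := by
  rw [map_nsmul]; ext i; simp [show (2 : ZMod 2) = 0 from rfl]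

theorem two_nsmul_nu (y : Fin (k + 2) → ZMod 2) : 2 • (nu y : Base k l) = 0 := by
  rw [← map_nsmul]
  have : 2 • y = 0 := by ext i; simp [show (2 : ZMod 2) = 0 from rfl]
  rw [this, map_zero]

/-- The additive form of `a_{i+2}`. -/
def basis (k l : ℕ) : Fin (k + 2) → Base k l :=
  Fin.cons (0, 1, 0) (fun j => (0, 0, Pi.single j 1))

theorem basis_zero : basis k l 0 = (0, 1, 0) := rfl

theorem basis_succ (j : Fin (k + 1)) : basis k l j.succ = (0, 0, Pi.single j 1) := rfl

theorem par_basis (i : Fin (k + 2)) : par (basis k l i) = Pi.single i 1 := by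
  refine Fin.cases ?_ (fun j => ?_) i <;> ext i <;> refine Fin.cases ?_ (fun j' => ?_) i
  · simp [basis_zero]
  · simp [basis_zero]
  · simp [basis_succ]
  · obtain rfl | h := eq_or_ne j' j
    · simp [basis_succ]
    · simp [basis_succ, h]

/-- Additive form of the relation `a_i² = [a_{i-1}, a_0]` for `i ≥ 3`. -/
theorem two_nsmul_basis_succ (j : Fin (k + 1)) :
    2 • basis k l j.succ = nu (par (basis k l j.castSucc)) := by
  rw [two_nsmul_base, par_basis, par_basis, nu_apply]
  ext i
  · simp [(Fin.castSucc_lt_last j).ne']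
  · simp [basis_succ]
  · obtain rfl | h := eq_or_ne i j
    · simp
    · simp [h]

theorem nu_par_basis_last :
    nu (par (basis k l (Fin.last _))) = ((1, 0, 0) : Base k l) := by
  rw [par_basis, nu_apply]
  ext i
  · simp
  · simp
  · simp [(Fin.castSucc_lt_last i).ne]

theorem eq_sum_basis (x : Base k l) : x = x.1.val • ((1, 0, 0) : Base k l) +
    (x.2.1.val • basis k l 0 + ∑ j : Fin (k + 1), (x.2.2 j).val • basis k l j.succ) := by
  have h : ∑ j : Fin (k + 1), (x.2.2 j).val • basis k l j.succ = (0, 0, x.2.2) := by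
    have : ∀ j, (x.2.2 j).val • basis k l j.succ = (0, 0, Pi.single j (x.2.2 j)) := by
      intro j
      rw [basis_succ]
      ext i
      · simp
      · simp
      · change (x.2.2 j).val • (Pi.single j 1 : Fin (k + 1) → ZMod 4) i =
          (Pi.single j (x.2.2 j) : Fin (k + 1) → ZMod 4) i
        obtain rfl | h := eq_or_ne i j
        · simp
        · simp [h]
    simp only [this]
    ext i
    · simp [Prod.fst_sum]
    · simp [Prod.fst_sum, Prod.snd_sum]
    · simp only [Prod.snd_sum, Finset.sum_apply, Finset.sum_pi_single]
      simp
  rw [h, basis_zero]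
  ext <;> simp

theorem hom_ext {B : Type*} [AddMonoid B] {f g : Base k l →+ B} (h1 : f (1, 0, 0) = g (1, 0, 0))
    (h : ∀ i, f (basis k l i) = g (basis k l i)) : f = g := by
  suffices f.eqLocusM g = ⊤ from AddMonoidHom.eq_of_eqOn_topM fun x _ => by
    have : x ∈ f.eqLocusM g := this ▸ AddSubmonoid.mem_top x
    exact this
  refine (AddSubmonoid.eq_top_iff' _).2 fun x => ?_
  rw [eq_sum_basis x]
  exact add_mem (nsmul_mem h1 _) (add_mem (nsmul_mem (h 0) _)
    (sum_mem fun j _ => nsmul_mem (h j.succ) _))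

theorem exists_zmod_hom {B : Type*} [AddCommGroup B] {r : ℕ} {b : B} (hb : r • b = 0) :
    ∃ f : ZMod r →+ B, f 1 = b := by
  refine ⟨ZMod.lift r ⟨zmultiplesHom B b, by simpa using hb⟩, ?_⟩
  simpa using ZMod.lift_coe r (⟨zmultiplesHom B b, by simpa using hb⟩ : {f : ℤ →+ B // f r = 0}) 1

theorem exists_hom {B : Type*} [AddCommGroup B] {u : B} {b : Fin (k + 2) → B}
    (hu : 2 • u = 0) (h0 : 2 ^ (l + 2) • b 0 = 0) (hb : ∀ j : Fin (k + 1), 4 • b j.succ = 0) :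
    ∃ f : Base k l →+ B, f (1, 0, 0) = u ∧ ∀ i, f (basis k l i) = b i := by
  obtain ⟨f1, hf1⟩ := exists_zmod_hom hu
  obtain ⟨f2, hf2⟩ := exists_zmod_hom h0
  choose f3 hf3 using fun j => exists_zmod_hom (hb j)
  refine ⟨f1.coprod (f2.coprod (∑ j, (f3 j).comp (Pi.evalAddMonoidHom _ j))), ?_, fun i => ?_⟩
  · simp [hf1]
  · refine Fin.cases ?_ (fun j => ?_) i
    · simp [basis_zero, hf2]
    · simp only [basis_succ, AddMonoidHom.coprod_apply, map_zero, zero_add,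
        AddMonoidHom.finsetSum_apply, AddMonoidHom.comp_apply, Pi.evalAddMonoidHom_apply]
      rw [Finset.sum_eq_single j, Pi.single_eq_same, hf3]
      · intro i _ hi; rw [Pi.single_eq_of_ne hi, map_zero]
      · simp

/-- Conjugation by `a_0`. -/
def twist : Base k l →+ Base k l := AddMonoidHom.id _ + nu.comp par

theorem twist_apply (x : Base k l) : twist x = x + nu (par x) := rfl

theorem par_twist (x : Base k l) : par (twist x) = par x := by
  rw [twist_apply, map_add, par_nu, add_zero]

/-- Commutators with `a_0` are central of exponent two, so `a_0²` acts trivially, as it must since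
it lies in `A`. -/
theorem twist_twist (x : Base k l) : twist (twist x) = x := by
  rw [twist_apply, par_twist, twist_apply, add_assoc, ← two_nsmul, two_nsmul_nu, add_zero]

theorem twist_of_par_eq_zero {x : Base k l} (h : par x = 0) : twist x = x := by
  rw [twist_apply, h, map_zero, add_zero]

/-- The additive form of `a_0 ^ 2`. -/
def sqZero (k l : ℕ) : Base k l := 2 • basis k l (Fin.last k).castSucc

theorem twist_sqZero : twist (sqZero k l) = sqZero k l :=
  twist_of_par_eq_zero (par_two_nsmul _)

/-- A model of `G_{k+3}(l+2,2)`: `⟨x, ε⟩` stands for the product of `x` and `a_0 ^ ε`. -/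
@[ext]
structure Model (k l : ℕ) where
  vec : Base k l
  tw : Bool

namespace Model

instance : Mul (Model k l) := ⟨fun a b =>
  ⟨a.vec + (if a.tw then twist b.vec else b.vec) + (if a.tw && b.tw then sqZero k l else 0),
    xor a.tw b.tw⟩⟩
instance : One (Model k l) := ⟨⟨0, false⟩⟩
instance : Inv (Model k l) := ⟨fun a =>
  ⟨if a.tw then -twist a.vec - sqZero k l else -a.vec, a.tw⟩⟩

theorem mul_def (a b : Model k l) : a * b =
    ⟨a.vec + (if a.tw then twist b.vec else b.vec) + (if a.tw && b.tw then sqZero k l else 0),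
      xor a.tw b.tw⟩ := rfl

theorem one_def : (1 : Model k l) = ⟨0, false⟩ := rfl

theorem inv_def (a : Model k l) :
    a⁻¹ = ⟨if a.tw then -twist a.vec - sqZero k l else -a.vec, a.tw⟩ := rfl

instance : Group (Model k l) :=
  Group.ofLeftAxioms
    (by
      rintro ⟨x, _ | _⟩ ⟨y, _ | _⟩ ⟨z, _ | _⟩ <;>
        simp [mul_def, twist_twist, twist_sqZero] <;> abel)
    (by rintro ⟨x, _ | _⟩ <;> simp [mul_def, one_def])
    (by rintro ⟨x, _ | _⟩
        · simp [mul_def, one_def, inv_def]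
        · simp only [mul_def, one_def, inv_def]; simp; abel)

theorem mk_false_mul (x y : Base k l) (ε : Bool) :
    (⟨x, false⟩ * ⟨y, ε⟩ : Model k l) = ⟨x + y, ε⟩ := by simp [mul_def]

theorem mk_true_mul_false (x y : Base k l) :
    (⟨x, true⟩ * ⟨y, false⟩ : Model k l) = ⟨x + twist y, true⟩ := by simp [mul_def]

theorem mk_true_mul_true (x y : Base k l) :
    (⟨x, true⟩ * ⟨y, true⟩ : Model k l) = ⟨x + twist y + sqZero k l, false⟩ := by simp [mul_def]

theorem mk_false_pow (x : Base k l) (r : ℕ) :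
    (⟨x, false⟩ : Model k l) ^ r = ⟨r • x, false⟩ := by
  induction r with
  | zero => simp [one_def]
  | succ r ih => rw [pow_succ, ih, mk_false_mul, succ_nsmul]

/-- The images of the `a_i` in the model. -/
def family (k l i : ℕ) : Model k l :=
  if i = 0 then ⟨0, true⟩ else if i = 1 then ⟨(1, 0, 0), false⟩
  else if h : i - 2 < k + 2 then ⟨basis k l ⟨i - 2, h⟩, false⟩ else 1

theorem family_zero : family k l 0 = ⟨0, true⟩ := rfl

theorem family_one : family k l 1 = ⟨(1, 0, 0), false⟩ := rfl

theorem family_add_two (i : Fin (k + 2)) : family k l (i + 2) = ⟨basis k l i, false⟩ := by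
  simp [family]

theorem exists_family_eq {i : ℕ} (h1 : 1 ≤ i) (h : i ≤ k + 3) :
    ∃ x, family k l i = ⟨x, false⟩ := by
  obtain rfl | h2 := h1.eq_or_lt
  · exact ⟨_, rfl⟩
  · obtain ⟨i, rfl⟩ := Nat.exists_eq_add_of_le' h2
    exact ⟨_, family_add_two ⟨i, by lia⟩⟩

theorem rightComm_mk_false (x y : Base k l) :
    rightComm ⟨x, false⟩ (⟨y, true⟩ : Model k l) = ⟨nu (par x), false⟩ := by
  rw [rightComm_eq_iff, mk_false_mul, mk_false_mul, mk_true_mul_false, ← twist_apply, twist_twist,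
    add_comm]

theorem two_nsmul_u : 2 • ((1, 0, 0) : Base k l) = 0 := by
  rw [← nu_par_basis_last, two_nsmul_nu]

theorem gnFamily : GnFamily (k + 3) (l + 2) 2 (family k l) where
  pow_one := by rw [family_one, mk_false_pow, two_nsmul_u]; rfl
  pow_two := by
    have : family k l 2 = _ := family_add_two 0
    rw [this, mk_false_pow, basis_zero, one_def]
    congr 1
    ext
    · simp
    · change 2 ^ (l + 2) • (1 : ZMod (2 ^ (l + 2))) = 0
      rw [nsmul_eq_mul, mul_one]
      exact ZMod.natCast_self _
    · simp
  pow_ge_three i h3 h := by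
    obtain ⟨i, rfl⟩ := Nat.exists_eq_add_of_le' h3
    have : family k l (i + 3) = _ := family_add_two (Fin.succ ⟨i, by lia⟩)
    rw [this, mk_false_pow, sq, mul_nsmul, two_nsmul_basis_succ, two_nsmul_nu]; rfl
  pow_zero := by
    have : family k l (k + 3 - 1) = _ := family_add_two (Fin.last k).castSucc
    rw [this, mk_false_pow, family_zero, sq, mk_true_mul_true, map_zero, zero_add, zero_add]; rfl
  comm_one_zero := by
    rw [family_one, family_zero, rightComm_mk_false, ← nu_par_basis_last, par_nu, map_zero]; rfl
  comm_last_zero := by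
    have : family k l (k + 3) = _ := family_add_two (Fin.last (k + 1))
    rw [this, family_zero, rightComm_mk_false, nu_par_basis_last]; rfl
  comm_pred_zero i h3 h := by
    obtain ⟨i, rfl⟩ := Nat.exists_eq_add_of_le' h3
    have h1 : family k l (i + 3) = _ := family_add_two (Fin.succ ⟨i, by lia⟩)
    have h2 : family k l (i + 3 - 1) = _ := family_add_two (Fin.castSucc ⟨i, by lia⟩)
    rw [h1, h2, family_zero, rightComm_mk_false, mk_false_pow, two_nsmul_basis_succ]
  comm_pos i j h1 hij h := by
    obtain ⟨x, hx⟩ := exists_family_eq (k := k) (l := l) h1 (by lia : i ≤ k + 3)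
    obtain ⟨y, hy⟩ := exists_family_eq (k := k) (l := l) (by lia : 1 ≤ j) h
    rw [hx, hy, rightComm_eq_one_iff, Commute, SemiconjBy, mk_false_mul, mk_false_mul, add_comm]

end Model

end GnTwo

/-! ### The model is isomorphic to the presented group -/

namespace GnTwo

variable {k l : ℕ}

theorem exists_base_hom : ∃ ι : Base k l →+ Additive (Gn (k + 3) (l + 2) 2),
    (ι (1, 0, 0)).toMul = Gn.gen (k + 3) (l + 2) 2 1 ∧
    ∀ i, (ι (basis k l i)).toMul = Gn.gen (k + 3) (l + 2) 2 (i + 2) := by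
  have hg : GnFamily (k + 3) (l + 2) 2 (Gn.gen (k + 3) (l + 2) 2) := Gn.gnFamily_gen (by lia)
  let S : Set (Gn (k + 3) (l + 2) 2) := Gn.gen (k + 3) (l + 2) 2 '' Set.Icc 1 (k + 3)
  -- The generators of this subgroup commute; adding commutativity to its existing group structure
  -- makes `exists_hom` applicable.
  let _ : CommGroup (Subgroup.closure S) :=
    { Subgroup.toGroup (Subgroup.closure S) with
      mul_comm := by
        have : ∀ x ∈ S, ∀ y ∈ S, x * y = y * x := by
          rintro _ ⟨i, hi, rfl⟩ _ ⟨j, hj, rfl⟩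
          exact hg.commute hi.1 hi.2 hj.1 hj.2
        have := Subgroup.isMulCommutative_closure this
        exact fun a b => this.is_comm.comm a b }
  have hmem : ∀ i, 1 ≤ i → i ≤ k + 3 → Gn.gen (k + 3) (l + 2) 2 i ∈ Subgroup.closure S :=
    fun i h1 h => Subgroup.subset_closure ⟨i, ⟨h1, h⟩, rfl⟩
  obtain ⟨f, hf1, hf⟩ := exists_hom (k := k) (l := l) (B := Additive (Subgroup.closure S))
    (u := .ofMul ⟨_, hmem 1 le_rfl (by lia)⟩)
    (b := fun i => .ofMul ⟨_, hmem (i + 2) (by lia) (by lia)⟩)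
    (congrArg Additive.ofMul (Subtype.ext hg.pow_one))
    (congrArg Additive.ofMul (Subtype.ext hg.pow_two))
    (fun j => congrArg Additive.ofMul (Subtype.ext (hg.pow_ge_three _ (by simp) (by simp; lia))))
  refine ⟨(MonoidHom.toAdditive (Subgroup.closure S).subtype).comp f, ?_, fun i => ?_⟩
  · simp only [AddMonoidHom.comp_apply, hf1]; rfl
  · simp only [AddMonoidHom.comp_apply, hf]; rfl

theorem exists_mulEquiv : Nonempty (Gn (k + 3) (l + 2) 2 ≃* Model k l) := by
  have hg : GnFamily (k + 3) (l + 2) 2 (Gn.gen (k + 3) (l + 2) 2) := Gn.gnFamily_gen (by lia)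
  obtain ⟨ι, hι1, hι⟩ := exists_base_hom (k := k) (l := l)
  set g := Gn.gen (k + 3) (l + 2) 2
  -- Both sides are homomorphic in `x` after conjugating, so the defining commutator relations on
  -- generators suffice.
  have hconj : ∀ x, (ι x).toMul * g 0 = g 0 * (ι (twist x)).toMul := by
    have : (MonoidHom.toAdditive (MulAut.conj (g 0)⁻¹).toMonoidHom).comp ι = ι.comp twist := by
      refine hom_ext ?_ fun i => ?_ <;>
        refine Additive.toMul.injective ?_ <;>
        rw [AddMonoidHom.comp_apply, AddMonoidHom.comp_apply, twist_apply] <;>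
        simp only [MonoidHom.coe_toAdditive, Function.comp_apply, toMul_ofMul,
          MulEquiv.toMonoidHom_eq_coe, MonoidHom.coe_coe, MulAut.conj_apply, inv_inv, map_add,
          toMul_add] <;>
        rw [mul_assoc, inv_mul_eq_iff_eq_mul]
      · rw [← nu_par_basis_last, par_nu, map_zero, map_zero, toMul_zero, mul_one, nu_par_basis_last,
          hι1]
        exact rightComm_eq_one_iff.1 hg.comm_one_zero
      · rw [← rightComm_eq_iff]
        refine Fin.lastCases ?_ (fun j => ?_) i
        · rw [nu_par_basis_last, hι1, hι]
          exact hg.comm_last_zero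
        · rw [← two_nsmul_basis_succ, map_nsmul, toMul_nsmul, hι, hι]
          exact hg.comm_pred_zero (j + 3) (by lia) (by lia)
    intro x
    have h := congrArg Additive.toMul (DFunLike.congr_fun this x)
    have h' : (g 0)⁻¹ * (ι x).toMul * g 0 = (ι (twist x)).toMul := by
      simpa using h
    rw [← h']; group
  have hconj' : ∀ x, g 0 * (ι x).toMul = (ι (twist x)).toMul * g 0 := by
    intro x; rw [hconj, twist_twist]
  have hsq : (ι (sqZero k l)).toMul = g 0 * g 0 := by
    rw [sqZero, map_nsmul, toMul_nsmul, hι, ← sq]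
    exact hg.pow_zero
  let ψ : Model k l →* Gn (k + 3) (l + 2) 2 := MonoidHom.mk'
    (fun a => (ι a.vec).toMul * if a.tw then g 0 else 1) (by
      rintro ⟨x, _ | _⟩ ⟨y, _ | _⟩
      · simp [Model.mul_def]
      · simp [Model.mul_def, mul_assoc]
      · simp [Model.mul_def, mul_assoc, hconj']
      · simp only [Model.mul_def, if_true, Bool.and_self, map_add, toMul_add, hsq, Bool.xor_self,
          mul_assoc]
        rw [← mul_assoc (g 0) _ (g 0), hconj', mul_assoc]
        simp)
  let φ := Gn.lift (Model.gnFamily (k := k) (l := l))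
  have hψφ : ψ.comp φ = MonoidHom.id _ := Gn.hom_ext fun i hi => by
    rw [MonoidHom.comp_apply, Gn.lift_gen _ hi, MonoidHom.id_apply]
    obtain rfl | h1 := Nat.eq_zero_or_pos i
    · simp [ψ, Model.family_zero, g]
    obtain rfl | h2 := Nat.eq_or_lt_of_le h1
    · simpa [ψ, Model.family_one] using hι1
    · obtain ⟨i, rfl⟩ := Nat.exists_eq_add_of_le' h2
      have : Model.family k l (i + 2) = _ := Model.family_add_two ⟨i, by lia⟩
      rw [Nat.succ_eq_add_one, show i + (1 + 1) = i + 2 from rfl, this]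
      simpa [ψ] using hι ⟨i, by lia⟩
  have hφψ : φ.comp ψ = MonoidHom.id _ := by
    have hφι : ∀ x, φ (ι x).toMul = ⟨x, false⟩ := by
      let incl : Base k l →+ Additive (Model k l) :=
        { toFun := fun x => .ofMul ⟨x, false⟩
          map_zero' := rfl
          map_add' := fun x y => congrArg Additive.ofMul (Model.mk_false_mul x y false).symm }
      have : (MonoidHom.toAdditive φ).comp ι = incl := by
        refine hom_ext ?_ fun i => ?_
        · exact congrArg Additive.ofMul (show φ (ι (1, 0, 0)).toMul = _ by
            rw [hι1, Gn.lift_gen _ (by lia)]; rfl)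
        · exact congrArg Additive.ofMul (show φ (ι _).toMul = ⟨basis k l i, false⟩ by
            rw [hι, Gn.lift_gen _ (by lia), Model.family_add_two])
      exact fun x => DFunLike.congr_fun this x
    ext1 ⟨x, ε⟩
    cases ε
    · simp [ψ, hφι]
    · simp only [ψ, MonoidHom.comp_apply, MonoidHom.mk'_apply, map_mul, hφι, if_true, g, φ,
        Gn.lift_gen _ (Nat.zero_le _), Model.family_zero, Model.mk_false_mul, add_zero,
        MonoidHom.id_apply]
  exact ⟨MonoidHom.toMulEquiv φ ψ hψφ hφψ⟩

end GnTwo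

theorem IsMillerGroup.of_mulEquiv {G H : Type*} [Group G] [Group H] (e : G ≃* H)
    (h : IsMillerGroup H) : IsMillerGroup G := fun φ ψ =>
  (MulAut.congr e).injective (by rw [map_mul, map_mul, h])

/-! ### Automorphisms of the model -/

namespace GnTwo

variable {k l : ℕ}

theorem exists_par_eq (t : Fin (k + 2) → ZMod 2) : ∃ x : Base k l, par x = t := by
  refine ⟨(0, (t 0).val, fun j => (t j.succ).val), ?_⟩
  ext i
  refine Fin.cases ?_ (fun j => ?_) i
  · rw [par_zero, map_natCast, ZMod.natCast_zmod_val]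
  · rw [par_succ, map_natCast, ZMod.natCast_zmod_val]

theorem two_nsmul_base_of_par_eq_zero {x : Base k l} (h : par x = 0) :
    2 • x = (0, 2 * x.2.1, 0) := by
  rw [two_nsmul_base, h]; simp; rfl

theorem par_basis_ne_zero (i : Fin (k + 2)) : par (basis k l i) ≠ 0 := fun h => by
  simpa [par_basis] using congrFun h i

/-- A Toeplitz matrix with zeros at the end of all rows but the last and at the beginning of all
rows but the first is scalar. -/
theorem eq_single_of_toeplitz {R : Type*} [Zero R] {M : Fin (k + 2) → Fin (k + 2) → R}
    (h1 : ∀ i j : Fin (k + 1), M i.succ j.succ = M i.castSucc j.castSucc)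
    (h2 : ∀ i : Fin (k + 1), M i.castSucc (Fin.last _) = 0)
    (h3 : ∀ i : Fin (k + 1), M i.succ 0 = 0) (i : Fin (k + 2)) :
    M i = Pi.single i (M 0 0) := by
  -- Constancy along diagonals carries the zeros of the first column down; the zeros of the last
  -- column are carried up in the same way.
  have lower : ∀ j i, j < i → M i j = 0 := by
    intro j
    induction j using Fin.induction with
    | zero =>
      intro i h
      obtain ⟨i, rfl⟩ := Fin.exists_succ_eq.2 h.ne'
      exact h3 i
    | succ j ih =>
      intro i h
      obtain ⟨i, rfl⟩ := Fin.exists_succ_eq.2 (Fin.ne_zero_of_lt h)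
      rw [h1]
      exact ih _ (by simpa using h)
  have upper : ∀ j i, i < j → M i j = 0 := by
    intro j
    induction j using Fin.reverseInduction with
    | last =>
      intro i h
      obtain ⟨i, rfl⟩ := Fin.exists_castSucc_eq.2 h.ne
      exact h2 i
    | cast j ih =>
      intro i h
      obtain ⟨i, rfl⟩ := Fin.exists_castSucc_eq.2 (Fin.ne_last_of_lt h)
      rw [← h1]
      exact ih _ (by simpa using h)
  have diag : ∀ i, M i i = M 0 0 := by
    intro i
    induction i using Fin.induction with
    | zero => rfl
    | succ i ih => rw [h1, ih]
  ext j
  rcases lt_trichotomy i j with h | rfl | h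
  · rw [upper _ _ h, Pi.single_eq_of_ne h.ne']
  · rw [diag, Pi.single_eq_same]
  · rw [lower _ _ h, Pi.single_eq_of_ne h.ne]

namespace Model

theorem commute_iff {a b : Model k l} :
    Commute a b ↔ (if a.tw then par b.vec else 0) = (if b.tw then par a.vec else 0) := by
  obtain ⟨x, _ | _⟩ := a <;> obtain ⟨y, _ | _⟩ := b <;>
    simp only [Commute, SemiconjBy, mk_false_mul, mk_true_mul_false, mk_true_mul_true, mk.injEq,
      twist_apply, and_true, if_true, Bool.false_eq_true, if_false]
  · simp [add_comm]
  · rw [add_comm x, add_right_inj, left_eq_add, map_eq_zero_iff _ nu_injective, eq_comm]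
  · rw [add_comm y, add_comm x, add_right_comm, add_comm y, add_assoc, add_eq_right,
      map_eq_zero_iff _ nu_injective]
  · rw [add_left_inj, ← add_assoc, ← add_assoc, add_comm y, add_right_inj, nu_injective.eq_iff]

theorem forall_commute_iff {a : Model k l} :
    (∀ b, Commute a b) ↔ a.tw = false ∧ par a.vec = 0 := by
  refine ⟨fun h => ?_, fun ⟨h1, h2⟩ b => by simp [commute_iff, h1, h2]⟩
  have ha : a.tw = false := by
    by_contra ha
    rw [Bool.not_eq_false] at ha
    have := commute_iff.1 (h ⟨basis k l 0, false⟩)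
    simp [ha, par_basis_ne_zero] at this
  have := commute_iff.1 (h ⟨0, true⟩)
  exact ⟨ha, by simpa [ha] using this.symm⟩

theorem forall_commute_map_iff (φ : MulAut (Model k l)) {a : Model k l} :
    (∀ b, Commute (φ a) b) ↔ ∀ b, Commute a b := by
  refine ⟨fun h b => ?_, fun h b => ?_⟩
  · exact φ.injective (by simpa using (h (φ b)).eq)
  · obtain ⟨b, rfl⟩ := φ.surjective b
    exact (h b).map φ

/-- Suppose `x ∈ A` leaves `A`. For noncentral `y ∈ A`, the image of `y` commutes with that of `x`,
hence lies outside `A` with the same class, and the image of `xy` is central. So all noncentral `y`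
have the class of `x`, yet `a_2` and `a_3` have different classes. -/
theorem tw_map (φ : MulAut (Model k l)) (x : Base k l) : (φ ⟨x, false⟩).tw = false := by
  by_contra ha
  rw [Bool.not_eq_false] at ha
  have key : ∀ y : Base k l, par y ≠ 0 → par x + par y = 0 := by
    intro y hy
    have hcomm : Commute (φ ⟨x, false⟩) (φ ⟨y, false⟩) :=
      (commute_iff.2 (by simp) : Commute (⟨x, false⟩ : Model k l) ⟨y, false⟩).map φ
    rw [commute_iff, ha, if_pos rfl] at hcomm
    cases hb : (φ ⟨y, false⟩).tw
    · rw [hb, if_neg (by simp)] at hcomm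
      exact absurd (forall_commute_iff.1
        ((forall_commute_map_iff φ).1 (forall_commute_iff.2 ⟨hb, hcomm⟩))).2 hy
    · rw [hb, if_pos rfl] at hcomm
      have : ∀ b, Commute (φ (⟨x, false⟩ * ⟨y, false⟩)) b := by
        rw [forall_commute_iff, map_mul, mul_def, ha, hb]
        refine ⟨rfl, ?_⟩
        simp only [if_true, Bool.and_self, map_add, par_twist, hcomm, sqZero, par_two_nsmul,
          add_zero]
        rw [← map_add, ← two_nsmul, par_two_nsmul]
      rw [forall_commute_map_iff, forall_commute_iff, mk_false_mul, map_add] at this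
      exact this.2
  have h := (key _ (par_basis_ne_zero 0)).trans (key _ (par_basis_ne_zero 1)).symm
  rw [add_right_inj, par_basis, par_basis] at h
  simpa using congrFun h 0

/-- The restriction of an automorphism to the abelian subgroup of index `2`. -/
def base (φ : MulAut (Model k l)) : Base k l →+ Base k l where
  toFun x := (φ ⟨x, false⟩).vec
  map_zero' := congrArg vec (map_one φ)
  map_add' x y := by
    rw [← mk_false_mul, map_mul, mul_def, tw_map]; simp

theorem map_mk_false (φ : MulAut (Model k l)) (x : Base k l) :
    φ ⟨x, false⟩ = ⟨base φ x, false⟩ :=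
  Model.ext rfl (tw_map φ x)

/-- An automorphism sends `a_0` to the product of this element and `a_0`. -/
def shift (φ : MulAut (Model k l)) : Base k l := (φ ⟨0, true⟩).vec

theorem map_mk_zero (φ : MulAut (Model k l)) : φ ⟨0, true⟩ = ⟨shift φ, true⟩ := by
  refine Model.ext rfl ?_
  -- Otherwise the whole image would lie in `A`, against surjectivity.
  by_contra h
  rw [Bool.not_eq_true] at h
  obtain ⟨⟨x, ε⟩, hx⟩ := φ.surjective ⟨0, true⟩
  cases ε
  · rw [map_mk_false] at hx; simp at hx
  · rw [← zero_add x, ← add_zero (0 + x), zero_add, ← mk_false_mul, map_mul, map_mk_false,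
      mul_def, h] at hx
    simp at hx

theorem map_mk_true (φ : MulAut (Model k l)) (x : Base k l) :
    φ ⟨x, true⟩ = ⟨base φ x + shift φ, true⟩ := by
  rw [← mk_false_mul, ← map_mk_zero, ← map_mk_false, ← map_mul, mk_false_mul, add_zero]

theorem base_nu_par (φ : MulAut (Model k l)) (x : Base k l) :
    base φ (nu (par x)) = nu (par (base φ x)) := by
  have h := map_rightComm φ.toMonoidHom ⟨x, false⟩ ⟨0, true⟩
  rw [rightComm_mk_false] at h
  simp only [MulEquiv.toMonoidHom_eq_coe, MonoidHom.coe_coe, map_mk_false, map_mk_zero] at h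
  rw [rightComm_mk_false] at h
  exact congrArg vec h

/-- Let `M` be the matrix of the action on `A` modulo the centre. Applying the automorphism to `a_i²
= [a_{i-1}, a_0]` and comparing the three components gives the hypotheses of
`eq_single_of_toeplitz`. So `M` is scalar over `ZMod 2`, and nonzero because `a_2` is not central.
-/
theorem par_base (φ : MulAut (Model k l)) (x : Base k l) : par (base φ x) = par x := by
  have key : ∀ j : Fin (k + 1), (0, 2 * (base φ (basis k l j.succ)).2.1,
      fun i : Fin (k + 1) => dbl (par (base φ (basis k l j.succ)) i.succ)) =
      nu (par (base φ (basis k l j.castSucc))) := by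
    intro j
    rw [← two_nsmul_base, ← map_nsmul, two_nsmul_basis_succ, base_nu_par]
  simp only [nu_apply, Prod.mk.injEq] at key
  have hM := eq_single_of_toeplitz (M := fun i => par (base φ (basis k l i)))
    (fun i j => dbl_injective (congrFun (key i).2.2 j))
    (fun i => (key i).1.symm)
    (fun i => red_eq_zero_of_two_mul (key i).2.1)
  have h00 : par (base φ (basis k l 0)) 0 = 1 := by
    have hone : ∀ z : ZMod 2, z ≠ 0 → z = 1 := by decide
    refine hone _ fun h0 => par_basis_ne_zero (k := k) (l := l) 0 ?_
    have h := hM 0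
    simp only [h0] at h
    rw [Pi.single_zero] at h
    have : ∀ b, Commute (φ ⟨basis k l 0, false⟩) b := by
      rw [forall_commute_iff, map_mk_false]; exact ⟨rfl, h⟩
    rw [forall_commute_map_iff, forall_commute_iff] at this
    exact this.2
  refine DFunLike.congr_fun (hom_ext (f := par.comp (base φ)) (g := par) ?_ fun i => ?_) x
  · rw [AddMonoidHom.comp_apply, ← nu_par_basis_last, base_nu_par, par_nu, par_nu]
  · rw [AddMonoidHom.comp_apply, par_basis, ← h00]
    exact hM i

/-- The difference of the restriction of an automorphism and the identity. -/
def dev (φ : MulAut (Model k l)) : Base k l →+ Base k l := base φ - AddMonoidHom.id _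

theorem dev_apply (φ : MulAut (Model k l)) (x : Base k l) : dev φ x = base φ x - x := rfl

theorem base_eq (φ : MulAut (Model k l)) (x : Base k l) : base φ x = x + dev φ x := by
  rw [dev_apply, add_sub_cancel]

theorem par_dev (φ : MulAut (Model k l)) (x : Base k l) : par (dev φ x) = 0 := by
  rw [dev_apply, map_sub, par_base, sub_self]

theorem dev_nu (φ : MulAut (Model k l)) (t : Fin (k + 2) → ZMod 2) : dev φ (nu t) = 0 := by
  obtain ⟨x, rfl⟩ := exists_par_eq (l := l) t
  rw [dev_apply, base_nu_par, par_base, sub_self]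

/-- The automorphism applied to `a_0² = a_{n-1}²`. -/
theorem two_nsmul_shift (φ : MulAut (Model k l)) :
    2 • shift φ + nu (par (shift φ)) = 2 • dev φ (basis k l (Fin.last k).castSucc) := by
  have h := congrArg φ (mk_true_mul_true (0 : Base k l) 0)
  rw [map_mul, map_mk_zero, mk_true_mul_true, map_mk_false, map_zero, zero_add, zero_add] at h
  have h' := congrArg vec h
  simp only [base_eq φ (sqZero k l), twist_apply] at h'
  rw [sqZero, map_nsmul, add_comm (2 • _), add_left_inj, ← add_assoc, ← two_nsmul] at h'
  exact h'

/-- In `two_nsmul_shift`, the `a_2`-component makes the first coordinate of the class vanish; the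
`ZMod 4` components equate each later coordinate with its predecessor. -/
theorem par_shift (φ : MulAut (Model k l)) : par (shift φ) = 0 := by
  have h := two_nsmul_shift φ
  rw [two_nsmul_base_of_par_eq_zero (par_dev φ _), two_nsmul_base, nu_apply] at h
  simp only [Prod.mk_add_mk, Prod.mk.injEq, add_zero] at h
  obtain ⟨-, h0, h1⟩ := h
  ext i
  induction i using Fin.induction with
  | zero =>
    rw [← sub_eq_zero, ← mul_sub] at h0
    have := red_eq_zero_of_two_mul h0
    rw [map_sub, ← par_zero, ← par_zero, par_dev, Pi.zero_apply, sub_zero] at this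
    exact this
  | succ i ih =>
    have := congrFun h1 i
    simp only [Pi.add_apply, ← map_add] at this
    rw [ih, Pi.zero_apply, add_zero, Pi.zero_apply, map_eq_zero_iff _ dbl_injective] at this
    exact this

/-- A central element is a multiple of `2 • a_2` plus a commutator. The commutator is killed, and
doubling a central value leaves only its `a_2`-coordinate. -/
theorem dev_of_par_eq_zero (φ : MulAut (Model k l)) {x : Base k l} (h : par x = 0) :
    dev φ x = (0, x.2.1 * (dev φ (basis k l 0)).2.1, 0) := by
  obtain ⟨y, hy⟩ := red_eq_zero_iff.1 (congrFun h 0)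
  have hdbl : ∀ z : ZMod 4, redFour z = 0 → ∃ t, z = dbl t := by decide
  choose t ht using fun j => hdbl (x.2.2 j) (congrFun h j.succ)
  have hx : x = y.val • 2 • basis k l 0 + nu (Fin.snoc t x.1) := by
    rw [nu_apply, basis_zero]
    ext i
    · simp
    · simp [hy, mul_comm]
    · simp [ht]
  have h2 := two_nsmul_base_of_par_eq_zero (par_dev φ (basis k l 0))
  conv_lhs => rw [hx, map_add, dev_nu, add_zero, map_nsmul, map_nsmul, h2]
  rw [hy]
  ext i
  · simp
  · simp; ring
  · simp

/-- The scalar by which `dev φ` acts on the centre is even, since `dev φ a_2` is central. -/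
theorem dev_eq_dev_of_two_nsmul_eq (φ : MulAut (Model k l)) {x y : Base k l} (hx : par x = 0)
    (hy : par y = 0) (h : 2 • x = 2 • y) : dev φ x = dev φ y := by
  rw [dev_of_par_eq_zero φ hx, dev_of_par_eq_zero φ hy]
  obtain ⟨s, hs⟩ := red_eq_zero_iff.1 (congrFun (par_dev φ (basis k l 0)) 0)
  rw [two_nsmul_base, two_nsmul_base, Prod.mk.injEq, Prod.mk.injEq] at h
  rw [hs, show x.2.1 * (2 * s) = 2 * x.2.1 * s by ring, h.2.1]
  ring_nf

/-- On `a_2` both orders give a product of two scalars in a commutative ring. For `i ≥ 3`, `2 • a_i`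
is a commutator, so `dev ψ a_i` is killed by `2` and then by `dev φ`. -/
theorem dev_dev_comm (φ ψ : MulAut (Model k l)) (x : Base k l) :
    dev φ (dev ψ x) = dev ψ (dev φ x) := by
  refine DFunLike.congr_fun
    (hom_ext (f := (dev φ).comp (dev ψ)) (g := (dev ψ).comp (dev φ)) ?_ fun i => ?_) x
  · simp only [AddMonoidHom.comp_apply, ← nu_par_basis_last, dev_nu, map_zero]
  · simp only [AddMonoidHom.comp_apply]
    refine Fin.cases ?_ (fun j => ?_) i
    · rw [dev_of_par_eq_zero φ (par_dev _ _), dev_of_par_eq_zero ψ (par_dev _ _), mul_comm]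
    · have key : ∀ φ ψ : MulAut (Model k l), dev φ (dev ψ (basis k l j.succ)) = 0 := by
        intro φ ψ
        rw [dev_eq_dev_of_two_nsmul_eq φ (par_dev _ _) (map_zero par), map_zero]
        rw [← map_nsmul, two_nsmul_basis_succ, dev_nu, nsmul_zero]
      rw [key, key]

/-- `shift ψ` and `dev ψ a_{n-1}` are central with equal doubles, so `dev φ` does not distinguish
them. -/
theorem dev_shift_comm (φ ψ : MulAut (Model k l)) : dev φ (shift ψ) = dev ψ (shift φ) := by
  have key : ∀ φ ψ : MulAut (Model k l),
      dev φ (shift ψ) = dev φ (dev ψ (basis k l (Fin.last k).castSucc)) := by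
    intro φ ψ
    refine dev_eq_dev_of_two_nsmul_eq φ (par_shift ψ) (par_dev _ _) ?_
    rw [← two_nsmul_shift, par_shift, map_zero, add_zero]
  rw [key, key, dev_dev_comm]

theorem isMillerGroup : IsMillerGroup (Model k l) := by
  intro φ ψ
  have hbase : ∀ x, base φ (base ψ x) = base ψ (base φ x) := by
    intro x
    simp only [base_eq, map_add, dev_dev_comm φ ψ]
    abel
  ext1 ⟨x, ε⟩
  rw [MulAut.mul_apply, MulAut.mul_apply]
  cases ε
  · simp only [map_mk_false, hbase]
  · simp only [map_mk_true, map_add, hbase]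
    rw [base_eq φ (shift ψ), base_eq ψ (shift φ), dev_shift_comm φ ψ]
    congr 1
    abel

end Model

end GnTwo

theorem theorem10p5 (n m p : ℕ) (hn : 3 ≤ n) (hm : 2 ≤ m) (hp : p.Prime) :
    IsMillerGroup (Gn n m p) ↔ p = 2 := by
  refine ⟨fun h => ?_, ?_⟩
  · by_contra h2
    exact Gn.not_isMillerGroup hn hm hp h2 h
  · rintro rfl
    obtain ⟨k, rfl⟩ := Nat.exists_eq_add_of_le' hn
    obtain ⟨l, rfl⟩ := Nat.exists_eq_add_of_le' hm
    obtain ⟨e⟩ := GnTwo.exists_mulEquiv (k := k) (l := l)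
    exact .of_mulEquiv e GnTwo.Model.isMillerGroup
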